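/- For $\lambda\in\mathbb R$ put $e_\lambda(x)=\exp(\lambda x)$. A (positive Borel) measure $\mu$ on $\mathbb R$ is exponentially integrable if $\int e_\lambda\,d\mu<\infty$ for all $\lambda\in\mathbb R$. Let $M_{\exp}(\mathbb R)$ be the set of exponentially integrable measures on $\mathbb R$ and $P_{\exp}(\mathbb R)\subset M_{\exp}(\mathbb R)$ the set of exponentially integrable probability measures. Let $\tau$ be the topology on $M_{\exp}(\mathbb R)$ determined by the seminorms $\mu\mapsto\left|\int f\,d\mu\right|$, where $f:\mathbb R\to\mathbb R$ runs over the continuous functions for which there are constants $c,C$ with $|f(x)|\le C\exp(c|x|)$ for all $x\in\mathbb R$; that is, $\tau$ is the coarsest topology for which all the maps $\mu\mapsto\int f\,d\mu$ are continuous. For probability measures $\mu,\nu$ on $\mathbb R$ write $\mu\le_{\mathrm{st}}\nu$ if $\mu[t,\infty)\le\nu[t,\infty)$ for all $t\in\mathbb R$. For $\mu,\nu\in P_{\exp}(\mathbb R)$ write $\mu\le^{C}_{\mathrm{st}}\nu$ if there is $\pi\in P_{\exp}(\mathbb R)$ such that $\mu*\pi\le_{\mathrm{st}}\nu*\pi$,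 where $*$ denotes convolution. Let $R^{C}=\{(\mu,\nu)\in P_{\exp}(\mathbb R)^2:\ \mu\le^{C}_{\mathrm{st}}\nu\}$. Then $$\overline{R^{C}}=\Big\{(\mu,\nu)\in P_{\exp}(\mathbb R)^2:\ \int e_\lambda\,d\mu\le\int e_\lambda\,d\nu\ \text{ for all }\lambda\ge 0,\ \text{ and }\ \int e_\lambda\,d\mu\ge\int e_\lambda\,d\nu\ \text{ for all }\lambda\le 0\Big\},$$ where the closure is taken in $M_{\exp}(\mathbb R)\times M_{\exp}(\mathbb R)$ with the product topology of $\tau$. -/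

import Mathlib

/-- A (positive, Borel) measure on `ℝ` is exponentially integrable if `∫ exp (l * x) dμ(x) < ∞`
for every real `l`. (Such a measure is finite: take `l = 0`.) -/
def ExpIntegrable (μ : MeasureTheory.Measure ℝ) : Prop :=
  ∀ l : ℝ, MeasureTheory.Integrable (fun x : ℝ => Real.exp (l * x)) μ

/-- The space of exponentially integrable measures on `ℝ`. -/
structure ExpMeasure where
  toMeasure : MeasureTheory.Measure ℝ
  expIntegrable : ExpIntegrable toMeasure

/-- The set of exponentially integrable probability measures on `ℝ`. -/
def PExp : Set ExpMeasure :=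
  {μ | MeasureTheory.IsProbabilityMeasure μ.toMeasure}

/-- Subexponential functions: `|f x| ≤ C * exp (c * |x|)` for some constants `c`, `C`. -/
def Subexponential (f : ℝ → ℝ) : Prop :=
  ∃ c C : ℝ, ∀ x : ℝ, |f x| ≤ C * Real.exp (c * |x|)

/-- The topology `τ` defined by the seminorms `μ ↦ |∫ f dμ|`, with `f` continuous and
subexponential. Since these are absolute values of functionals that are linear in `μ`, the basic
neighbourhoods of `μ` are the finite intersections of sets `{μ' | |∫ f dμ' - ∫ f dμ| < ε}`; so `τ`
is the coarsest topology for which all maps `μ ↦ ∫ f dμ` are continuous. -/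
noncomputable instance ExpMeasure.instTopologicalSpace : TopologicalSpace ExpMeasure :=
  ⨅ f : {f : ℝ → ℝ // Continuous f ∧ Subexponential f},
    TopologicalSpace.induced (fun μ : ExpMeasure => ∫ x, f.1 x ∂μ.toMeasure) inferInstance

/-- Stochastic domination: `μ [t, ∞) ≤ ν [t, ∞)` for every real `t`. It is used for probability
measures only. -/
def StochDominated (μ ν : MeasureTheory.Measure ℝ) : Prop :=
  ∀ t : ℝ, μ (Set.Ici t) ≤ ν (Set.Ici t)

/-- Catalytic stochastic domination: after convolution with some exponentially integrable
probability measure `π`, the first measure is stochastically dominated by the second. -/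
def CatStochDominated (μ ν : MeasureTheory.Measure ℝ) : Prop :=
  ∃ π : ExpMeasure, π ∈ PExp ∧
    StochDominated (MeasureTheory.Measure.conv μ π.toMeasure)
      (MeasureTheory.Measure.conv ν π.toMeasure)

/-- The set of pairs `(μ, ν)` of exponentially integrable probability measures such that `μ` is
catalytically stochastically dominated by `ν`. -/
def catRelation : Set (ExpMeasure × ExpMeasure) :=
  {p | p.1 ∈ PExp ∧ p.2 ∈ PExp ∧ CatStochDominated p.1.toMeasure p.2.toMeasure}

/-! For the inclusion from left to right: stochastic domination orders the moment generating
functions on each half-line by the layer-cake formula. Convolution multiplies these functions, so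
the finite positive factor of the catalyst cancels. Each resulting condition tests against some `exp
(l * x)`, an admissible test function, hence is closed for `τ`.

The converse rests on an algebraic fact about laws on a common finite lattice `h k + s`. With `x =
exp (l * h)`, the moment generating functions become generating polynomials `p`, `q`, up to a common
positive factor. Strict ordering away from `l = 0`, with a linear gap at `0`, says `q - p = (X - 1)
* R` with `R > 0` on `(0, ∞)`. By Poincaré's theorem (`exists_nonneg_coeff_mul`) some `P` with
nonnegative coefficients makes `P * R` have nonnegative coefficients. Normalised by `P(1) = 1`, this
`P` is the law of a catalyst: `P * q - P * p = (X - 1) * (P * R)`, and summation by parts orders all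
tails (`catStochDominated_map_lattice`).

A general pair is brought to this case by three approximations in `τ`: one-sided truncation
(`mgfRelation_subset_closure`), mixing with far point masses to make the inequalities strict
(`boundedMgfRelation_subset_closure`), and outward rounding to a finite lattice
(`strictMgfRelation_subset_closure`). -/

/-! ### Multipliers with nonnegative coefficients -/

open Polynomial in
theorem coeff_mul_nonneg_of_coeff_nonneg {p q : ℝ[X]} (hp : ∀ k, 0 ≤ p.coeff k)
    (hq : ∀ k, 0 ≤ q.coeff k) (k : ℕ) : 0 ≤ (p * q).coeff k := by
  rw [coeff_mul]
  exact Finset.sum_nonneg fun x _ => mul_nonneg (hp _) (hq _)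

open Polynomial in
theorem coeff_quadratic_nonneg {b c : ℝ} (hb : 0 ≤ b) (hc : 0 ≤ c) (k : ℕ) :
    0 ≤ (X ^ 2 + C b * X + C c : ℝ[X]).coeff k := by
  simp only [coeff_add, coeff_X_pow, coeff_C_mul, coeff_X, coeff_C]
  split_ifs <;> simp <;> linarith

open Polynomial in
/-- A quadratic without real roots has a multiple with nonnegative coefficients, by a multiplier
with nonnegative coefficients: multiplication by `X ^ 2 + b X + s ^ 2` doubles the argument of the
roots. -/
theorem exists_nonneg_coeff_mul_quadratic (n : ℕ) : ∀ b s : ℝ, 0 < s → |b| < 2 * s →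
    2 * s ≤ 2 ^ n * (2 * s - b) →
    ∃ P : ℝ[X], P ≠ 0 ∧ (∀ k, 0 ≤ P.coeff k) ∧
      ∀ k, 0 ≤ (P * (X ^ 2 - C b * X + C (s ^ 2))).coeff k := by
  have base : ∀ b s : ℝ, b ≤ 0 → ∃ P : ℝ[X], P ≠ 0 ∧ (∀ k, 0 ≤ P.coeff k) ∧
      ∀ k, 0 ≤ (P * (X ^ 2 - C b * X + C (s ^ 2))).coeff k := by
    intro b s hb
    refine ⟨1, one_ne_zero, fun k => ?_, fun k => ?_⟩
    · rw [coeff_one]; split_ifs <;> norm_num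
    · have := coeff_quadratic_nonneg (b := -b) (c := s ^ 2) (by linarith) (by positivity) k
      rw [C_neg, neg_mul, ← sub_eq_add_neg] at this
      rwa [one_mul]
  induction n with
  | zero =>
    intro b s _ _ h
    exact base b s (by linarith)
  | succ n ih =>
    intro b s hs hbs h
    rcases le_or_gt b 0 with hb | hb
    · exact base b s hb
    rw [abs_lt] at hbs
    have h1 : s ≤ 2 ^ n * (2 * s - b) := by rw [pow_succ] at h; linarith
    -- For roots `s * exp (± i θ)` one has `b = 2 s cos θ`, and `b ^ 2 - 2 s ^ 2 = 2 s ^ 2 cos 2θ`.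
    -- The new gap is `(2 s - b) * (2 s + b)`; since `b > 0`, the gap relative to `2 s` at least
    -- doubles, so one power of `2` is used up.
    obtain ⟨P, hP0, hP, hPq⟩ := ih (b ^ 2 - 2 * s ^ 2) (s ^ 2) (by positivity)
      (by rw [abs_lt]; constructor <;> nlinarith)
      (by
        have := mul_le_mul h1 (show 2 * s ≤ 2 * s + b by linarith) (by positivity)
          (hs.le.trans h1)
        nlinarith)
    refine ⟨expand ℝ 2 P * (X ^ 2 + C b * X + C (s ^ 2)), ?_, ?_, ?_⟩
    · refine mul_ne_zero ((expand_ne_zero two_pos).2 hP0) fun h0 => ?_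
      have := congrArg (eval 1) h0
      simp only [eval_add, eval_mul, eval_pow, eval_X, eval_C, eval_zero] at this
      nlinarith
    · refine coeff_mul_nonneg_of_coeff_nonneg (fun k => ?_)
        (coeff_quadratic_nonneg hb.le (by positivity))
      rw [coeff_expand two_pos]
      split_ifs
      exacts [hP _, le_rfl]
    · intro k
      have : expand ℝ 2 P * (X ^ 2 + C b * X + C (s ^ 2)) * (X ^ 2 - C b * X + C (s ^ 2)) =
          expand ℝ 2 (P * (X ^ 2 - C (b ^ 2 - 2 * s ^ 2) * X + C ((s ^ 2) ^ 2))) := by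
        simp only [map_mul, map_add, map_sub, expand_C, expand_X, map_pow, map_ofNat]
        ring
      rw [this, coeff_expand two_pos]
      split_ifs
      exacts [hPq _, le_rfl]

open Polynomial in
/-- **Poincaré's theorem**: a monic real polynomial without positive roots has a multiple with
nonnegative coefficients, by a multiplier with nonnegative coefficients. -/
theorem exists_nonneg_coeff_mul {q : ℝ[X]} (hq : q.Monic) (hr : ∀ x, 0 < x → q.eval x ≠ 0) :
    ∃ P : ℝ[X], P ≠ 0 ∧ (∀ k, 0 ≤ P.coeff k) ∧ ∀ k, 0 ≤ (P * q).coeff k := by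
  induction hn : q.natDegree using Nat.strong_induction_on generalizing q with
  | _ n ih =>
    have one_nonneg : ∀ k, 0 ≤ (1 : ℝ[X]).coeff k := fun k => by
      rw [coeff_one]; split_ifs <;> norm_num
    by_cases hu : IsUnit q
    · exact ⟨1, one_ne_zero, one_nonneg, by rw [hq.eq_one_of_isUnit hu, one_mul]; exact one_nonneg⟩
    obtain ⟨f, hf, hfi, g, rfl⟩ := exists_monic_irreducible_factor q hu
    have hg : g.Monic := hf.of_mul_monic_left hq
    have hdeg := hf.natDegree_mul hg
    have hfd := hfi.natDegree_pos
    obtain ⟨P, hP0, hP, hPg⟩ := ih g.natDegree (by omega) hg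
      (fun x hx h => hr x hx (by rw [eval_mul, h, mul_zero])) rfl
    obtain ⟨F, hF0, hF, hFf⟩ : ∃ F : ℝ[X], F ≠ 0 ∧ (∀ k, 0 ≤ F.coeff k) ∧
        ∀ k, 0 ≤ (F * f).coeff k := by
      have hd : f.natDegree ≤ 2 := natDegree_le_of_degree_le hfi.degree_le_two
      have hroot : ∀ x, 0 < x → f.eval x ≠ 0 := fun x hx h =>
        hr x hx (by rw [eval_mul, h, zero_mul])
      obtain h1 | h2 : f.natDegree = 1 ∨ f.natDegree = 2 := by omega
      · refine ⟨1, one_ne_zero, one_nonneg, ?_⟩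
        have hfe := hf.eq_X_add_C h1
        have h0 : 0 ≤ f.coeff 0 := by
          by_contra! hneg
          refine hroot (-f.coeff 0) (by linarith) ?_
          rw [hfe]; simp
        intro k
        rw [one_mul, hfe]
        simp only [coeff_add, coeff_X, coeff_C]
        split_ifs <;> norm_num <;> linarith
      · have hfe : f = X ^ 2 - C (-f.coeff 1) * X + C (f.coeff 0) := by
          have h2' : f.coeff 2 = 1 := by rw [← h2]; exact hf
          conv_lhs => rw [f.as_sum_range_C_mul_X_pow, h2]
          simp [Finset.sum_range_succ, h2']
          ring
        have hnr : ∀ x, f.eval x ≠ 0 := fun x hx => by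
          have := degree_eq_one_of_irreducible_of_root hfi hx
          rw [degree_eq_natDegree hf.ne_zero, h2] at this
          norm_num at this
        have hdisc : (f.coeff 1) ^ 2 < 4 * f.coeff 0 := by
          by_contra! hneg
          refine hnr ((-f.coeff 1 + √(f.coeff 1 ^ 2 - 4 * f.coeff 0)) / 2) ?_
          rw [hfe]
          have := Real.sq_sqrt (show 0 ≤ f.coeff 1 ^ 2 - 4 * f.coeff 0 by linarith)
          simp
          nlinarith
        have hc : 0 < f.coeff 0 := by nlinarith [sq_nonneg (f.coeff 1)]
        have hs := Real.sqrt_pos.2 hc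
        have hss := Real.sq_sqrt hc.le
        have hb : |-f.coeff 1| < 2 * √(f.coeff 0) := by
          apply abs_lt_of_sq_lt_sq _ (by positivity)
          nlinarith
        have hpos : 0 < 2 * √(f.coeff 0) - -f.coeff 1 := by
          have := (abs_lt.1 hb).2
          linarith
        obtain ⟨n, hn⟩ := pow_unbounded_of_one_lt
          (2 * √(f.coeff 0) / (2 * √(f.coeff 0) - -f.coeff 1)) one_lt_two
        rw [div_lt_iff₀ hpos] at hn
        have := exists_nonneg_coeff_mul_quadratic n (-f.coeff 1) (√(f.coeff 0)) hs hb hn.le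
        rwa [hss, ← hfe] at this
    refine ⟨F * P, mul_ne_zero hF0 hP0, coeff_mul_nonneg_of_coeff_nonneg hF hP, fun k => ?_⟩
    rw [show F * P * (f * g) = (F * f) * (P * g) by ring]
    exact coeff_mul_nonneg_of_coeff_nonneg hFf hPg k

/-! ### Pairing coefficients with weights -/

open Polynomial in
/-- The linear functional `∑ aₖ X ^ k ↦ ∑ f k * aₖ`. -/
noncomputable def coeffSum (f : ℕ → ℝ) : ℝ[X] →ₗ[ℝ] ℝ :=
  lsum fun k => f k • LinearMap.id

open Polynomial in
theorem coeffSum_monomial (f : ℕ → ℝ) (k : ℕ) (a : ℝ) :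
    coeffSum f (monomial k a) = f k * a := by
  simp [coeffSum, lsum_apply]

open Polynomial in
theorem coeffSum_eq_sum (f : ℕ → ℝ) (p : ℝ[X]) :
    coeffSum f p = ∑ k ∈ Finset.range (p.natDegree + 1), f k * p.coeff k := by
  conv_lhs => rw [p.as_sum_range]
  simp [coeffSum_monomial]

open Polynomial in
theorem coeffSum_mul (f : ℕ → ℝ) (P p : ℝ[X]) :
    coeffSum f (P * p) = ∑ k ∈ Finset.range (P.natDegree + 1),
      P.coeff k * coeffSum (fun i => f (i + k)) p := by
  have (k : ℕ) (a : ℝ) : coeffSum f (monomial k a * p) = a * coeffSum (fun i => f (i + k)) p := by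
    induction p using Polynomial.induction_on' with
    | add p q hp hq => rw [mul_add, map_add, map_add, hp, hq, mul_add]
    | monomial i c =>
      rw [monomial_mul_monomial, coeffSum_monomial, coeffSum_monomial, add_comm k i]
      ring
  conv_lhs => rw [P.as_sum_range, Finset.sum_mul]
  simp [this]

open Polynomial in
theorem coeffSum_pow (z : ℝ) (p : ℝ[X]) : coeffSum (fun k => z ^ k) p = p.eval z := by
  rw [coeffSum_eq_sum, eval_eq_sum_range]
  exact Finset.sum_congr rfl fun _ _ => mul_comm _ _

open Polynomial in
theorem coeffSum_nonneg {f : ℕ → ℝ} {p : ℝ[X]} (hf : ∀ k, 0 ≤ f k) (hp : ∀ k, 0 ≤ p.coeff k) :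
    0 ≤ coeffSum f p := by
  rw [coeffSum_eq_sum]
  exact Finset.sum_nonneg fun k _ => mul_nonneg (hf k) (hp k)

-- Summation by parts: multiplying by `X - 1` turns the weight `f` into its increments, which are
-- nonnegative.
open Polynomial in
theorem coeffSum_X_sub_one_mul_nonneg {f : ℕ → ℝ} {R : ℝ[X]} (hf : Monotone f)
    (hR : ∀ k, 0 ≤ R.coeff k) : 0 ≤ coeffSum f ((X - 1) * R) := by
  have : coeffSum f ((X - 1) * R) = coeffSum (fun k => f (k + 1) - f k) R := by
    clear hR
    induction R using Polynomial.induction_on' with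
    | add p q hp hq => rw [mul_add, map_add, map_add, hp, hq]
    | monomial i c =>
      rw [sub_mul, one_mul, X_mul_monomial, map_sub]
      simp only [coeffSum_monomial]
      ring
  rw [this]
  exact coeffSum_nonneg (fun k => sub_nonneg.2 (hf k.le_succ)) hR

open Polynomial in
/-- If `q - p` vanishes to first order at `1` and changes sign there and nowhere else on `(0, ∞)`,
then `p` and `q` have multiples that are ordered as seen by all monotone weights. -/
theorem exists_coeffSum_mul_le {p q R : ℝ[X]} (hR : q - p = (X - 1) * R)
    (hpos : ∀ x, 0 < x → 0 < R.eval x) :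
    ∃ P : ℝ[X], P.eval 1 = 1 ∧ (∀ k, 0 ≤ P.coeff k) ∧
      ∀ f : ℕ → ℝ, Monotone f → coeffSum f (P * p) ≤ coeffSum f (P * q) := by
  have hR0 : R ≠ 0 := by
    rintro rfl
    simpa using hpos 1 one_pos
  have hlc : R.leadingCoeff ≠ 0 := leadingCoeff_ne_zero.2 hR0
  obtain ⟨P, hP0, hP, hPR⟩ := exists_nonneg_coeff_mul
    (q := R * C R.leadingCoeff⁻¹) (monic_mul_leadingCoeff_inv hR0) (fun x hx => by
      rw [eval_mul, eval_C]
      exact mul_ne_zero (hpos x hx).ne' (inv_ne_zero hlc))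
  have eval_pos : 0 < P.eval 1 := by
    rw [eval_eq_sum_range]
    refine Finset.sum_pos' (fun k _ => by simpa using hP k) ⟨P.natDegree, by simp, ?_⟩
    have : P.coeff P.natDegree ≠ 0 := by simpa using hP0
    simpa using lt_of_le_of_ne (hP _) this.symm
  -- Poincaré's theorem was applied to the monic multiple of `R`; comparing values at `1` shows that
  -- the scalar is positive, so it does not affect signs of coefficients.
  have hlc_pos : 0 < R.leadingCoeff⁻¹ := by
    have h0 : 0 ≤ coeffSum (fun k => 1 ^ k) (P * (R * C R.leadingCoeff⁻¹)) :=
      coeffSum_nonneg (by simp) hPR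
    rw [coeffSum_pow, eval_mul, eval_mul, eval_C] at h0
    refine lt_of_le_of_ne ?_ (inv_ne_zero hlc).symm
    have h1 := nonneg_of_mul_nonneg_right h0 eval_pos
    exact nonneg_of_mul_nonneg_right h1 (hpos 1 one_pos)
  have hPR' : ∀ k, 0 ≤ (P * R).coeff k := fun k => by
    have := hPR k
    rw [← mul_assoc, coeff_mul_C] at this
    exact nonneg_of_mul_nonneg_left this hlc_pos
  refine ⟨C (P.eval 1)⁻¹ * P, ?_, fun k => ?_, fun f hf => ?_⟩
  · rw [eval_mul, eval_C, inv_mul_cancel₀ eval_pos.ne']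
  · rw [coeff_C_mul]
    exact mul_nonneg (inv_nonneg.2 eval_pos.le) (hP k)
  · rw [← sub_nonneg, ← map_sub, ← mul_sub, hR,
      show C (P.eval 1)⁻¹ * P * ((X - 1) * R) = (X - 1) * (C (P.eval 1)⁻¹ * (P * R)) by ring]
    refine coeffSum_X_sub_one_mul_nonneg hf fun k => ?_
    rw [coeff_C_mul]
    exact mul_nonneg (inv_nonneg.2 eval_pos.le) (hPR' k)

/-! ### Lattice laws and their generating polynomials -/

open Polynomial MeasureTheory in
/-- The generating polynomial of the law of `a` under `μ`, for `a` bounded by `K`. -/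
noncomputable def levelPoly (μ : Measure ℝ) (a : ℝ → ℕ) (K : ℕ) : ℝ[X] :=
  ∑ k ∈ Finset.range (K + 1), monomial k (μ.real (a ⁻¹' {k}))

open Polynomial MeasureTheory in
theorem integral_comp_eq_coeffSum {μ : Measure ℝ} [IsFiniteMeasure μ] {a : ℝ → ℕ} {K : ℕ}
    (ha : Measurable a) (haK : ∀ x, a x ≤ K) (g : ℕ → ℝ) :
    ∫ x, g (a x) ∂μ = coeffSum g (levelPoly μ a K) := by
  have : (fun x => g (a x)) = fun x => ∑ k ∈ Finset.range (K + 1),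
      (a ⁻¹' {k}).indicator (fun _ => g k) x := by
    funext x
    rw [Finset.sum_eq_single (a x)]
    · simp
    · intro k _ hk
      simp [hk.symm]
    · intro h
      exact absurd (Finset.mem_range.2 (Nat.lt_succ_of_le (haK x))) h
  have hm (k : ℕ) : MeasurableSet (a ⁻¹' {k}) := ha (measurableSet_singleton k)
  rw [this, integral_finsetSum _ fun k _ => (integrable_const _).indicator (hm k)]
  simp [levelPoly, coeffSum_monomial, integral_indicator_const _ (hm _), mul_comm]

open MeasureTheory Polynomial in
/-- A finite combination of point masses on the lattice `h ℕ`. -/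
noncomputable def latticeMeasure (h : ℝ) (P : ℝ[X]) : Measure ℝ :=
  ∑ k ∈ Finset.range (P.natDegree + 1), ENNReal.ofReal (P.coeff k) • Measure.dirac (h * k)

open MeasureTheory Polynomial in
theorem isProbabilityMeasure_latticeMeasure (h : ℝ) {P : ℝ[X]} (hP : ∀ k, 0 ≤ P.coeff k)
    (h1 : P.eval 1 = 1) : IsProbabilityMeasure (latticeMeasure h P) := by
  constructor
  have : ∑ k ∈ Finset.range (P.natDegree + 1), P.coeff k = 1 := by
    rw [← h1, eval_eq_sum_range]
    simp
  simp [latticeMeasure, ← ENNReal.ofReal_sum_of_nonneg fun k _ => hP k, this]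

open MeasureTheory Polynomial in
theorem expIntegrable_latticeMeasure (h : ℝ) (P : ℝ[X]) : ExpIntegrable (latticeMeasure h P) := by
  intro l
  rw [latticeMeasure, integrable_finsetSum_measure]
  exact fun k _ => (integrable_dirac (by simp)).smul_measure ENNReal.ofReal_ne_top

-- Convolution on the lattice is multiplication of generating polynomials. A tail is then a pairing
-- with an indicator weight, which is monotone in the lattice index when `0 ≤ h`.
open MeasureTheory Polynomial in
theorem conv_latticeMeasure_Ici {μ : Measure ℝ} [IsProbabilityMeasure μ] {a : ℝ → ℕ} {K : ℕ}
    (ha : Measurable a) (haK : ∀ x, a x ≤ K) {h s : ℝ} {P : ℝ[X]} (hP : ∀ k, 0 ≤ P.coeff k)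
    (h1 : P.eval 1 = 1) (t : ℝ) :
    ((μ.map fun x => h * a x + s).conv (latticeMeasure h P)) (Set.Ici t) =
      ENNReal.ofReal (coeffSum ((Set.Ici t).indicator (fun _ => (1 : ℝ)) ∘ fun i : ℕ => h * i + s)
        (P * levelPoly μ a K)) := by
  have := isProbabilityMeasure_latticeMeasure h hP h1
  have hm : Measurable fun x => h * a x + s := by fun_prop
  have := Measure.isProbabilityMeasure_map (μ := μ) hm.aemeasurable
  have hcs (k : ℕ) : coeffSum (fun i => ((Set.Ici t).indicator (fun _ => (1 : ℝ)) ∘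
      fun i : ℕ => h * i + s) (i + k)) (levelPoly μ a K) =
      μ.real {x | t ≤ h * k + (h * a x + s)} := by
    rw [← integral_comp_eq_coeffSum ha haK, ← integral_indicator_one
      (measurableSet_le measurable_const (by fun_prop))]
    congr 1 with x
    simp only [Set.indicator, Function.comp, Set.mem_Ici, Set.mem_ofPred_eq, Pi.one_apply]
    congr 2
    push_cast
    ring
  rw [Measure.conv_comm, ← lintegral_indicator_one measurableSet_Ici,
    Measure.lintegral_conv (measurable_one.indicator measurableSet_Ici)]
  conv_lhs => rw [latticeMeasure]
  rw [lintegral_finsetSum_measure, coeffSum_mul,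
    ENNReal.ofReal_sum_of_nonneg fun k _ => mul_nonneg (hP k) (by rw [hcs]; positivity)]
  refine Finset.sum_congr rfl fun k _ => ?_
  have key : ∫⁻ y, (Set.Ici t).indicator 1 (h * k + y) ∂(μ.map fun x => h * a x + s) =
      μ {x | t ≤ h * k + (h * a x + s)} := by
    rw [lintegral_map (f := fun y => (Set.Ici t).indicator (1 : ℝ → ENNReal) (h * k + y))
      ((measurable_one.indicator measurableSet_Ici).comp (measurable_const_add _)) hm,
      ← lintegral_indicator_one (measurableSet_le measurable_const (by fun_prop))]
    rfl
  rw [lintegral_smul_measure, lintegral_dirac, hcs, ENNReal.ofReal_mul (hP k), ofReal_measureReal,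
    key, smul_eq_mul]

open MeasureTheory Polynomial Filter Topology in
/-- On a lattice, strict inequality of the moment generating functions, with a first order
inequality at `0`, implies catalytic stochastic domination. -/
theorem catStochDominated_map_lattice {μ ν : Measure ℝ} [IsProbabilityMeasure μ]
    [IsProbabilityMeasure ν] {a b : ℝ → ℕ} {K : ℕ} (ha : Measurable a) (hb : Measurable b)
    (haK : ∀ x, a x ≤ K) (hbK : ∀ x, b x ≤ K) {h s c : ℝ} (hh : 0 < h) (hc : 0 < c)
    (hpos : ∀ l, 0 < l →
      ∫ x, Real.exp (l * (h * a x + s)) ∂μ < ∫ x, Real.exp (l * (h * b x + s)) ∂ν)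
    (hneg : ∀ l, l < 0 →
      ∫ x, Real.exp (l * (h * b x + s)) ∂ν < ∫ x, Real.exp (l * (h * a x + s)) ∂μ)
    (hlin : ∀ᶠ l in 𝓝[>] (0 : ℝ), c * l ≤
      ∫ x, Real.exp (l * (h * b x + s)) ∂ν - ∫ x, Real.exp (l * (h * a x + s)) ∂μ) :
    CatStochDominated (μ.map fun x => h * a x + s) (ν.map fun x => h * b x + s) := by
  have mgf_eq (ρ : Measure ℝ) [IsProbabilityMeasure ρ] (d : ℝ → ℕ) (hd : Measurable d)
      (hdK : ∀ x, d x ≤ K) (l : ℝ) : ∫ x, Real.exp (l * (h * d x + s)) ∂ρ =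
      Real.exp (l * s) * (levelPoly ρ d K).eval (Real.exp (l * h)) := by
    rw [← coeffSum_pow, ← integral_comp_eq_coeffSum hd hdK, ← integral_const_mul]
    congr 1 with x
    rw [← Real.exp_nat_mul, ← Real.exp_add]
    ring_nf
  simp only [mgf_eq μ a ha haK, mgf_eq ν b hb hbK] at hpos hneg hlin
  set p := levelPoly μ a K
  set q := levelPoly ν b K
  have heval (ρ : Measure ℝ) [IsProbabilityMeasure ρ] (d : ℝ → ℕ) (hd : Measurable d)
      (hdK : ∀ x, d x ≤ K) : (levelPoly ρ d K).eval 1 = 1 := by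
    have := mgf_eq ρ d hd hdK 0
    simpa using this.symm
  obtain ⟨R, hR⟩ : X - C 1 ∣ q - p := by
    rw [dvd_iff_isRoot, IsRoot, eval_sub, heval μ a ha haK, heval ν b hb hbK, sub_self]
  rw [C_1] at hR
  have hRe (x : ℝ) : (x - 1) * R.eval x = q.eval x - p.eval x := by
    rw [← eval_sub, hR]
    simp
  have hRpos : ∀ x, 0 < x → 0 < R.eval x := by
    intro x hx
    have hexp : Real.exp (Real.log x / h * h) = x := by
      rw [div_mul_cancel₀ _ hh.ne', Real.exp_log hx]
    rcases lt_trichotomy x 1 with h1 | rfl | h1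
    · have := hneg (Real.log x / h) (div_neg_of_neg_of_pos (Real.log_neg hx h1) hh)
      rw [hexp] at this
      have := lt_of_mul_lt_mul_left this (Real.exp_pos _).le
      have := hRe x
      nlinarith
    -- At `x = 1` strict ordering gives no information on `R`. The linear gap together with `exp (l
    -- * h) - 1 ≤ l * h * exp (l * h)` bounds `R` from below near `1`, and letting `l` decrease to
    -- `0` yields `R(1) ≥ c / h`.
    · have hlim : Tendsto (fun l : ℝ => R.eval (Real.exp (l * h))) (𝓝[>] 0) (𝓝 (R.eval 1)) := by
        have : Continuous fun l : ℝ => R.eval (Real.exp (l * h)) := by fun_prop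
        have := this.tendsto 0
        simp only [zero_mul, Real.exp_zero] at this
        exact this.mono_left nhdsWithin_le_nhds
      have hlim2 : Tendsto (fun l : ℝ => c * Real.exp (-(l * s)) / (h * Real.exp (l * h)))
          (𝓝[>] 0) (𝓝 (c / h)) := by
        have : Continuous fun l : ℝ => c * Real.exp (-(l * s)) / (h * Real.exp (l * h)) := by
          refine Continuous.div (by fun_prop) (by fun_prop) fun l => by positivity
        have := this.tendsto 0
        simp only [zero_mul, Real.exp_zero, neg_zero, mul_one] at this
        exact this.mono_left nhdsWithin_le_nhds
      refine (div_pos hc hh).trans_le (le_of_tendsto_of_tendsto hlim2 hlim ?_)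
      filter_upwards [hlin, self_mem_nhdsWithin] with l hl hl0
      have hl0 : 0 < l := hl0
      rw [← mul_sub, ← hRe] at hl
      have hx1 : 0 < Real.exp (l * h) - 1 := by
        have := Real.add_one_lt_exp (x := l * h) (by positivity)
        nlinarith [mul_pos hl0 hh]
      have hx2 : Real.exp (l * h) - 1 ≤ l * (h * Real.exp (l * h)) := by
        have h3 := Real.add_one_le_exp (-(l * h))
        have h4 : Real.exp (-(l * h)) * Real.exp (l * h) = 1 := by
          rw [← Real.exp_add]; simp
        nlinarith [Real.exp_pos (l * h)]
      rw [div_le_iff₀ (by positivity), Real.exp_neg, ← div_eq_mul_inv,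
        div_le_iff₀ (Real.exp_pos _)]
      have hRp : 0 ≤ R.eval (Real.exp (l * h)) := by
        by_contra! hlt
        have := mul_pos hc hl0
        have := mul_neg_of_pos_of_neg (Real.exp_pos (l * s)) (mul_neg_of_pos_of_neg hx1 hlt)
        linarith
      refine le_of_mul_le_mul_right ?_ hl0
      calc c * l ≤ Real.exp (l * s) * ((Real.exp (l * h) - 1) * R.eval (Real.exp (l * h))) := hl
        _ ≤ Real.exp (l * s) * ((l * (h * Real.exp (l * h))) * R.eval (Real.exp (l * h))) := by
          gcongr
        _ = _ := by ring
    · have := hpos (Real.log x / h) (div_pos (Real.log_pos h1) hh)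
      rw [hexp] at this
      have := lt_of_mul_lt_mul_left this (Real.exp_pos _).le
      have := hRe x
      by_contra! hle
      nlinarith
  obtain ⟨P, hP1, hP, hPle⟩ := exists_coeffSum_mul_le hR hRpos
  refine ⟨⟨latticeMeasure h P, expIntegrable_latticeMeasure h P⟩,
    isProbabilityMeasure_latticeMeasure h hP hP1, fun t => ?_⟩
  rw [conv_latticeMeasure_Ici ha haK hP hP1, conv_latticeMeasure_Ici hb hbK hP hP1]
  refine ENNReal.ofReal_le_ofReal (hPle _ fun i j hij => ?_)
  have : h * (i : ℝ) + s ≤ h * j + s := by gcongr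
  simp only [Function.comp, Set.indicator, Set.mem_Ici]
  split_ifs <;> linarith

/-! ### The topology `τ` and the closed necessary condition -/

open MeasureTheory in
theorem ExpMeasure.continuous_integral {f : ℝ → ℝ} (hf : Continuous f) (hs : Subexponential f) :
    Continuous fun μ : ExpMeasure => ∫ x, f x ∂μ.toMeasure :=
  continuous_iff_le_induced.2 <|
    iInf_le (fun f : {f : ℝ → ℝ // Continuous f ∧ Subexponential f} =>
      TopologicalSpace.induced (fun μ : ExpMeasure => ∫ x, f.1 x ∂μ.toMeasure) inferInstance)
      ⟨f, hf, hs⟩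

open MeasureTheory Filter Topology in
theorem ExpMeasure.tendsto_of_tendsto_integral {ι : Type*} {l : Filter ι} {u : ι → ExpMeasure}
    {μ : ExpMeasure} (h : ∀ f : ℝ → ℝ, Continuous f → Subexponential f →
      Tendsto (fun i => ∫ x, f x ∂(u i).toMeasure) l (𝓝 (∫ x, f x ∂μ.toMeasure))) :
    Tendsto u l (𝓝 μ) := by
  rw [nhds_iInf, tendsto_iInf]
  intro f
  rw [nhds_induced, tendsto_comap_iff]
  exact h f.1 f.2.1 f.2.2

theorem subexponential_exp (l : ℝ) : Subexponential fun x => Real.exp (l * x) := by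
  refine ⟨|l|, 1, fun x => ?_⟩
  rw [Real.abs_exp, one_mul, ← abs_mul]
  exact Real.exp_le_exp.2 (le_abs_self _)

open MeasureTheory in
theorem ExpMeasure.isFiniteMeasure (μ : ExpMeasure) : IsFiniteMeasure μ.toMeasure := by
  have := μ.expIntegrable 0
  simpa [integrable_const_iff] using this

-- Expresses total mass one through an admissible test function, so that being a probability measure
-- is a closed condition.
open MeasureTheory in
theorem mem_PExp_iff (μ : ExpMeasure) : μ ∈ PExp ↔ ∫ x, Real.exp (0 * x) ∂μ.toMeasure = 1 := by
  have := μ.isFiniteMeasure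
  simp [PExp, ← isProbabilityMeasure_iff_real]

-- With lower integrals, convolution becomes multiplicative without any integrability to check.
open MeasureTheory in
theorem integral_exp_le_integral_exp_iff (μ ν : ExpMeasure) (l : ℝ) :
    ∫ x, Real.exp (l * x) ∂μ.toMeasure ≤ ∫ x, Real.exp (l * x) ∂ν.toMeasure ↔
    ∫⁻ x, ENNReal.ofReal (Real.exp (l * x)) ∂μ.toMeasure ≤
      ∫⁻ x, ENNReal.ofReal (Real.exp (l * x)) ∂ν.toMeasure := by
  have h (ρ : ExpMeasure) := ofReal_integral_eq_lintegral_ofReal (ρ.expIntegrable l)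
    (.of_forall fun x => (Real.exp_pos _).le)
  rw [← h, ← h, ENNReal.ofReal_le_ofReal_iff (integral_nonneg fun x => (Real.exp_pos _).le)]

open MeasureTheory in
theorem lintegral_exp_conv (μ π : Measure ℝ) [SFinite π] (l : ℝ) :
    ∫⁻ x, ENNReal.ofReal (Real.exp (l * x)) ∂(μ.conv π) =
      (∫⁻ x, ENNReal.ofReal (Real.exp (l * x)) ∂μ) *
        ∫⁻ x, ENNReal.ofReal (Real.exp (l * x)) ∂π := by
  rw [Measure.lintegral_conv (by fun_prop), ← lintegral_mul_const _ (by fun_prop)]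
  congr 1 with x
  rw [← lintegral_const_mul _ (by fun_prop)]
  congr 1 with y
  rw [← ENNReal.ofReal_mul (Real.exp_pos _).le, ← Real.exp_add, mul_add]

-- Layer-cake formula: the superlevel sets of an increasing exponential are closed upper half-lines.
open MeasureTheory in
theorem lintegral_exp_le_of_stochDominated {μ ν : Measure ℝ} (h : StochDominated μ ν) {l : ℝ}
    (hl : 0 < l) : ∫⁻ x, ENNReal.ofReal (Real.exp (l * x)) ∂μ ≤
      ∫⁻ x, ENNReal.ofReal (Real.exp (l * x)) ∂ν := by
  rw [lintegral_eq_lintegral_meas_le _ (.of_forall fun x => (Real.exp_pos _).le) (by fun_prop),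
    lintegral_eq_lintegral_meas_le _ (.of_forall fun x => (Real.exp_pos _).le) (by fun_prop)]
  refine setLIntegral_mono' measurableSet_Ioi fun t (ht : 0 < t) => ?_
  have : {a | t ≤ Real.exp (l * a)} = Set.Ici (Real.log t / l) := by
    ext a
    simp [← Real.log_le_iff_le_exp ht, div_le_iff₀' hl]
  rw [this]
  exact h _

-- Here the strict superlevel sets are complements of closed upper half-lines; equal total mass
-- reverses the inequality of tails.
open MeasureTheory in
theorem lintegral_exp_le_of_stochDominated_of_neg {μ ν : Measure ℝ} [IsProbabilityMeasure μ]
    [IsProbabilityMeasure ν] (h : StochDominated μ ν) {l : ℝ}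
    (hl : l < 0) : ∫⁻ x, ENNReal.ofReal (Real.exp (l * x)) ∂ν ≤
      ∫⁻ x, ENNReal.ofReal (Real.exp (l * x)) ∂μ := by
  rw [lintegral_eq_lintegral_meas_lt _ (.of_forall fun x => (Real.exp_pos _).le) (by fun_prop),
    lintegral_eq_lintegral_meas_lt _ (.of_forall fun x => (Real.exp_pos _).le) (by fun_prop)]
  refine setLIntegral_mono' measurableSet_Ioi fun t (ht : 0 < t) => ?_
  have : {a | t < Real.exp (l * a)} = (Set.Ici (Real.log t / l))ᶜ := by
    ext a
    simp [← Real.log_lt_iff_lt_exp ht, lt_div_iff_of_neg' hl]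
  rw [this, prob_compl_eq_one_sub measurableSet_Ici, prob_compl_eq_one_sub measurableSet_Ici]
  exact tsub_le_tsub_left (h _) _

/-- The pairs of exponentially integrable probability measures whose moment generating functions
are ordered on both half-lines. -/
def mgfRelation : Set (ExpMeasure × ExpMeasure) :=
  {p : ExpMeasure × ExpMeasure | p.1 ∈ PExp ∧ p.2 ∈ PExp ∧
    (∀ l : ℝ, 0 ≤ l →
      ∫ x, Real.exp (l * x) ∂p.1.toMeasure ≤ ∫ x, Real.exp (l * x) ∂p.2.toMeasure) ∧
    (∀ l : ℝ, l ≤ 0 →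
      ∫ x, Real.exp (l * x) ∂p.2.toMeasure ≤ ∫ x, Real.exp (l * x) ∂p.1.toMeasure)}

theorem isClosed_mgfRelation : IsClosed mgfRelation := by
  have hc (l : ℝ) := ExpMeasure.continuous_integral (f := fun x => Real.exp (l * x))
    (by fun_prop) (subexponential_exp l)
  have h1 (l : ℝ) := (hc l).comp (continuous_fst (X := ExpMeasure) (Y := ExpMeasure))
  have h2 (l : ℝ) := (hc l).comp (continuous_snd (X := ExpMeasure) (Y := ExpMeasure))
  simp only [mgfRelation, mem_PExp_iff, Set.ofPred_and, Set.ofPred_forall]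
  refine .inter (isClosed_eq (h1 0) continuous_const) (.inter (isClosed_eq (h2 0) continuous_const)
    (.inter ?_ ?_))
  · exact isClosed_iInter fun l => isClosed_iInter fun _ => isClosed_le (h1 l) (h2 l)
  · exact isClosed_iInter fun l => isClosed_iInter fun _ => isClosed_le (h2 l) (h1 l)

open MeasureTheory in
theorem catRelation_subset_mgfRelation : catRelation ⊆ mgfRelation := by
  rintro ⟨μ, ν⟩ ⟨hμ, hν, π, hπ, h⟩
  have : IsProbabilityMeasure μ.toMeasure := hμ
  have : IsProbabilityMeasure ν.toMeasure := hν
  have : IsProbabilityMeasure π.toMeasure := hπ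
  have hpos (l : ℝ) : ∫⁻ x, ENNReal.ofReal (Real.exp (l * x)) ∂π.toMeasure ≠ 0 := by
    rw [← ofReal_integral_eq_lintegral_ofReal (π.expIntegrable l)
      (.of_forall fun x => (Real.exp_pos _).le)]
    simpa using integral_exp_pos (π.expIntegrable l)
  have htop (l : ℝ) : ∫⁻ x, ENNReal.ofReal (Real.exp (l * x)) ∂π.toMeasure ≠ ⊤ := by
    rw [← ofReal_integral_eq_lintegral_ofReal (π.expIntegrable l)
      (.of_forall fun x => (Real.exp_pos _).le)]
    exact ENNReal.ofReal_ne_top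
  have h0 : ∫ x, Real.exp (0 * x) ∂μ.toMeasure = ∫ x, Real.exp (0 * x) ∂ν.toMeasure := by simp
  refine ⟨hμ, hν, fun l hl => ?_, fun l hl => ?_⟩
  · rcases hl.eq_or_lt with rfl | hl
    · exact h0.le
    rw [integral_exp_le_integral_exp_iff, ← ENNReal.mul_le_mul_iff_left (hpos l) (htop l),
      ← lintegral_exp_conv, ← lintegral_exp_conv]
    exact lintegral_exp_le_of_stochDominated h hl
  · rcases hl.eq_or_lt with rfl | hl
    · exact h0.ge
    rw [integral_exp_le_integral_exp_iff, ← ENNReal.mul_le_mul_iff_left (hpos l) (htop l),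
      ← lintegral_exp_conv, ← lintegral_exp_conv]
    exact lintegral_exp_le_of_stochDominated_of_neg h hl

/-! ### Approximation by images and by mixtures -/

open MeasureTheory in
theorem ExpMeasure.integrable_exp_abs (μ : ExpMeasure) (c : ℝ) :
    Integrable (fun x => Real.exp (c * |x|)) μ.toMeasure := by
  refine ((μ.expIntegrable c).add (μ.expIntegrable (-c))).mono' (by fun_prop)
    (.of_forall fun x => ?_)
  rw [Real.norm_eq_abs, Real.abs_exp]
  have h1 := Real.exp_pos (c * x)
  have h2 := Real.exp_pos (-c * x)
  simp only [Pi.add_apply]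
  rcases abs_choice x with h | h <;> rw [h]
  · linarith
  · rw [show c * -x = -c * x by ring]
    linarith

open MeasureTheory in
theorem ExpMeasure.integrable (μ : ExpMeasure) {f : ℝ → ℝ} (hf : Measurable f)
    (hs : Subexponential f) : Integrable f μ.toMeasure := by
  obtain ⟨c, C, h⟩ := hs
  exact ((μ.integrable_exp_abs c).const_mul C).mono' hf.aestronglyMeasurable (.of_forall h)

/-- Supplies one dominating function for `f ∘ u`, uniform over all maps `u` with `|u x| ≤ |x| + 1`.
-/
theorem Subexponential.exists_abs_le {f : ℝ → ℝ} (hf : Subexponential f) :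
    ∃ c C : ℝ, 0 ≤ C ∧ ∀ x y, |y| ≤ |x| + 1 → |f y| ≤ C * Real.exp (c * |x|) := by
  obtain ⟨c, C, h⟩ := hf
  have hC : 0 ≤ C := by
    have := (abs_nonneg _).trans (h 0)
    simpa using this
  refine ⟨|c|, C * Real.exp |c|, by positivity, fun x y hxy => (h y).trans ?_⟩
  rw [mul_assoc, ← Real.exp_add]
  gcongr
  calc c * |y| ≤ |c| * (|x| + 1) := by gcongr; exact le_abs_self c
    _ = |c| + |c| * |x| := by ring

open MeasureTheory in
/-- The image of an exponentially integrable measure under a map at bounded distance from being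
norm decreasing. -/
noncomputable def ExpMeasure.map (μ : ExpMeasure) (u : ℝ → ℝ) (hu : Measurable u)
    (hb : ∀ x, |u x| ≤ |x| + 1) : ExpMeasure where
  toMeasure := μ.toMeasure.map u
  expIntegrable l := by
    rw [integrable_map_measure (by fun_prop) hu.aemeasurable]
    obtain ⟨c, C, -, h⟩ := (subexponential_exp l).exists_abs_le
    exact μ.integrable (by fun_prop) ⟨c, C, fun x => h x _ (hb x)⟩

open MeasureTheory in
theorem ExpMeasure.map_mem_PExp {μ : ExpMeasure} (h : μ ∈ PExp) {u : ℝ → ℝ} (hu : Measurable u)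
    (hb : ∀ x, |u x| ≤ |x| + 1) : μ.map u hu hb ∈ PExp := by
  have : IsProbabilityMeasure μ.toMeasure := h
  exact Measure.isProbabilityMeasure_map hu.aemeasurable

open MeasureTheory in
theorem ExpMeasure.integral_map (μ : ExpMeasure) {u : ℝ → ℝ} (hu : Measurable u)
    (hb : ∀ x, |u x| ≤ |x| + 1) {f : ℝ → ℝ} (hf : Continuous f) :
    ∫ x, f x ∂(μ.map u hu hb).toMeasure = ∫ x, f (u x) ∂μ.toMeasure :=
  MeasureTheory.integral_map hu.aemeasurable hf.aestronglyMeasurable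

open MeasureTheory Filter Topology in
theorem ExpMeasure.tendsto_map (μ : ExpMeasure) {u : ℕ → ℝ → ℝ} (hu : ∀ n, Measurable (u n))
    (hb : ∀ n x, |u n x| ≤ |x| + 1) (h : ∀ x, Tendsto (fun n => u n x) atTop (𝓝 x)) :
    Tendsto (fun n => μ.map (u n) (hu n) (hb n)) atTop (𝓝 μ) := by
  refine ExpMeasure.tendsto_of_tendsto_integral fun f hf hs => ?_
  simp only [μ.integral_map _ _ hf]
  obtain ⟨c, C, -, hC⟩ := hs.exists_abs_le
  refine tendsto_integral_of_dominated_convergence (fun x => C * Real.exp (c * |x|))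
    (fun n => (hf.measurable.comp (hu n)).aestronglyMeasurable)
    ((μ.integrable_exp_abs c).const_mul C) (fun n => .of_forall fun x => hC x _ (hb n x))
    (.of_forall fun x => (hf.tendsto x).comp (h x))

open MeasureTheory in
/-- The mixture `(1 - ε) μ + ε δₐ`. -/
noncomputable def ExpMeasure.mix (μ : ExpMeasure) (a ε : ℝ) : ExpMeasure where
  toMeasure := ENNReal.ofReal (1 - ε) • μ.toMeasure + ENNReal.ofReal ε • Measure.dirac a
  expIntegrable l := ((μ.expIntegrable l).smul_measure ENNReal.ofReal_ne_top).add_measure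
    ((integrable_dirac (by simp)).smul_measure ENNReal.ofReal_ne_top)

open MeasureTheory in
theorem ExpMeasure.integral_mix (μ : ExpMeasure) (a : ℝ) {ε : ℝ} (h0 : 0 ≤ ε) (h1 : ε ≤ 1)
    {f : ℝ → ℝ} (hf : Continuous f) (hs : Subexponential f) :
    ∫ x, f x ∂(μ.mix a ε).toMeasure = (1 - ε) * ∫ x, f x ∂μ.toMeasure + ε * f a := by
  rw [mix, integral_add_measure
    ((μ.integrable hf.measurable hs).smul_measure ENNReal.ofReal_ne_top)
    ((integrable_dirac (by simp)).smul_measure ENNReal.ofReal_ne_top), integral_smul_measure,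
    integral_smul_measure, integral_dirac, ENNReal.toReal_ofReal (by linarith),
    ENNReal.toReal_ofReal h0, smul_eq_mul, smul_eq_mul]

open MeasureTheory in
theorem ExpMeasure.mix_mem_PExp {μ : ExpMeasure} (h : μ ∈ PExp) (a : ℝ) {ε : ℝ} (h0 : 0 ≤ ε)
    (h1 : ε ≤ 1) : μ.mix a ε ∈ PExp := by
  rw [mem_PExp_iff] at h ⊢
  rw [μ.integral_mix a h0 h1 (f := fun x => Real.exp (0 * x)) (by fun_prop) (subexponential_exp 0),
    h]
  simp

open MeasureTheory Filter Topology in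
theorem ExpMeasure.tendsto_mix (μ : ExpMeasure) (a : ℝ) :
    Tendsto (fun n : ℕ => μ.mix a (1 / ((n : ℝ) + 1))) atTop (𝓝 μ) := by
  refine ExpMeasure.tendsto_of_tendsto_integral fun f hf hs => ?_
  have h (n : ℕ) : 1 / ((n : ℝ) + 1) ≤ 1 := by
    rw [div_le_one (by positivity)]
    linarith [n.cast_nonneg (α := ℝ)]
  simp only [fun n : ℕ => μ.integral_mix a (by positivity) (h n) hf hs]
  have h0 := tendsto_one_div_add_atTop_nhds_zero_nat (𝕜 := ℝ)
  simpa using ((h0.const_sub 1).mul_const (∫ x, f x ∂μ.toMeasure)).add (h0.mul_const (f a))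

/-- The pairs of `mgfRelation` whose first measure is bounded above, and whose second measure is
bounded below. -/
def boundedMgfRelation : Set (ExpMeasure × ExpMeasure) :=
  {p | p ∈ mgfRelation ∧ ∃ A : ℝ, 0 ≤ A ∧ (∀ᵐ x ∂p.1.toMeasure, x ≤ A) ∧
    ∀ᵐ x ∂p.2.toMeasure, -A ≤ x}

-- Replacing `x` by `min x n` under `μ` and by `max x (-n)` under `ν` moves `μ` down and `ν` up, so
-- every required inequality survives.
open MeasureTheory Filter Topology in
theorem mgfRelation_subset_closure : mgfRelation ⊆ closure boundedMgfRelation := by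
  rintro ⟨μ, ν⟩ ⟨hμ, hν, hpos, hneg⟩
  have hu (n : ℕ) : Measurable fun x : ℝ => min x (n : ℝ) := by fun_prop
  have hv (n : ℕ) : Measurable fun x : ℝ => max x (-n : ℝ) := by fun_prop
  have hub (n : ℕ) (x : ℝ) : |min x (n : ℝ)| ≤ |x| + 1 := by
    have := n.cast_nonneg (α := ℝ)
    rcases min_cases x (n : ℝ) with ⟨h, _⟩ | ⟨h, h'⟩ <;> rw [h]
    · linarith
    · rw [abs_of_nonneg this]; linarith [le_abs_self x]
  have hvb (n : ℕ) (x : ℝ) : |max x (-n : ℝ)| ≤ |x| + 1 := by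
    have := n.cast_nonneg (α := ℝ)
    rcases max_cases x (-n : ℝ) with ⟨h, _⟩ | ⟨h, h'⟩ <;> rw [h]
    · linarith
    · rw [abs_neg, abs_of_nonneg this]; linarith [neg_abs_le x]
  have htu : Tendsto (fun n : ℕ => μ.map _ (hu n) (hub n)) atTop (𝓝 μ) := by
    refine μ.tendsto_map hu hub fun x => tendsto_const_nhds.congr' ?_
    filter_upwards [eventually_ge_atTop ⌈x⌉₊] with n hn
    exact (min_eq_left (Nat.ceil_le.1 hn)).symm
  have htv : Tendsto (fun n : ℕ => ν.map _ (hv n) (hvb n)) atTop (𝓝 ν) := by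
    refine ν.tendsto_map hv hvb fun x => tendsto_const_nhds.congr' ?_
    filter_upwards [eventually_ge_atTop ⌈-x⌉₊] with n hn
    exact (max_eq_left (by linarith [Nat.ceil_le.1 hn])).symm
  refine mem_closure_of_tendsto (htu.prodMk_nhds htv) (.of_forall fun n => ?_)
  have hiu (l : ℝ) : Integrable (fun x => Real.exp (l * min x (n : ℝ))) μ.toMeasure := by
    have := (μ.map _ (hu n) (hub n)).expIntegrable l
    exact (integrable_map_measure (by fun_prop) (hu n).aemeasurable).1 this
  have hiv (l : ℝ) : Integrable (fun x => Real.exp (l * max x (-n : ℝ))) ν.toMeasure := by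
    have := (ν.map _ (hv n) (hvb n)).expIntegrable l
    exact (integrable_map_measure (by fun_prop) (hv n).aemeasurable).1 this
  refine ⟨⟨ExpMeasure.map_mem_PExp hμ (hu n) (hub n),
    ExpMeasure.map_mem_PExp hν (hv n) (hvb n), fun l hl => ?_,
    fun l hl => ?_⟩, n, n.cast_nonneg, ?_, ?_⟩
  · rw [μ.integral_map _ _ (by fun_prop), ν.integral_map _ _ (by fun_prop)]
    calc ∫ x, Real.exp (l * min x (n : ℝ)) ∂μ.toMeasure
        ≤ ∫ x, Real.exp (l * x) ∂μ.toMeasure := by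
          refine integral_mono (hiu l) (μ.expIntegrable l) fun x => ?_
          exact Real.exp_le_exp.2 (mul_le_mul_of_nonneg_left (min_le_left _ _) hl)
      _ ≤ _ := hpos l hl
      _ ≤ _ := by
          refine integral_mono (ν.expIntegrable l) (hiv l) fun x => ?_
          exact Real.exp_le_exp.2 (mul_le_mul_of_nonneg_left (le_max_left _ _) hl)
  · rw [μ.integral_map _ _ (by fun_prop), ν.integral_map _ _ (by fun_prop)]
    calc ∫ x, Real.exp (l * max x (-n : ℝ)) ∂ν.toMeasure
        ≤ ∫ x, Real.exp (l * x) ∂ν.toMeasure := by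
          refine integral_mono (hiv l) (ν.expIntegrable l) fun x => ?_
          exact Real.exp_le_exp.2 (mul_le_mul_of_nonpos_left (le_max_left _ _) hl)
      _ ≤ _ := hneg l hl
      _ ≤ _ := by
          refine integral_mono (μ.expIntegrable l) (hiu l) fun x => ?_
          exact Real.exp_le_exp.2 (mul_le_mul_of_nonpos_left (min_le_left _ _) hl)
  · exact (ae_map_iff (hu n).aemeasurable measurableSet_Iic).2 (.of_forall fun x => min_le_right _ _)
  · exact (ae_map_iff (hv n).aemeasurable measurableSet_Ici).2 (.of_forall fun x => le_max_right _ _)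

open MeasureTheory in
/-- The pairs of probability measures whose moment generating functions are strictly ordered,
with room for perturbations both near `0` and at infinity. -/
def strictMgfRelation : Set (ExpMeasure × ExpMeasure) :=
  {p | p.1 ∈ PExp ∧ p.2 ∈ PExp ∧ ∃ A c : ℝ, 0 ≤ A ∧ 0 < c ∧
    (∀ᵐ x ∂p.1.toMeasure, x ≤ A) ∧ (∀ᵐ x ∂p.2.toMeasure, -A ≤ x) ∧
    c ≤ p.2.toMeasure.real (Set.Ici (A + 1)) ∧ c ≤ p.1.toMeasure.real (Set.Iic (-(A + 1))) ∧
    (∀ l, 0 < l → ∫ x, Real.exp (l * x) ∂p.1.toMeasure + c * l ≤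
      ∫ x, Real.exp (l * x) ∂p.2.toMeasure) ∧
    ∀ l, l < 0 → ∫ x, Real.exp (l * x) ∂p.2.toMeasure + c * (-l) ≤
      ∫ x, Real.exp (l * x) ∂p.1.toMeasure}

/-- The gain, per unit of mass, from an atom at `A + 1` in the larger measure and one at `-(A + 1)`
in the smaller. -/
theorem mul_le_exp_sub_exp_neg {A l : ℝ} (hA : 0 ≤ A) (hl : 0 < l) :
    l ≤ Real.exp (l * (A + 1)) - Real.exp (l * (-(A + 1))) := by
  have h1 := Real.add_one_le_exp (l * (A + 1))
  have h2 : Real.exp (l * (-(A + 1))) ≤ 1 := Real.exp_le_one_iff.2 (by nlinarith)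
  nlinarith [mul_nonneg hl.le hA]

open MeasureTheory in
theorem ExpMeasure.le_real_mix (μ : ExpMeasure) {a ε : ℝ} {s : Set ℝ} (ha : a ∈ s) :
    ε ≤ (μ.mix a ε).toMeasure.real s := by
  have := (μ.mix a ε).isFiniteMeasure
  rw [measureReal_def, ← ENNReal.ofReal_le_iff_le_toReal (measure_ne_top _ _)]
  simp [mix, Set.indicator_of_mem ha]

open MeasureTheory in
theorem ExpMeasure.ae_mix {μ : ExpMeasure} {p : ℝ → Prop} (h : ∀ᵐ x ∂μ.toMeasure, p x) {a : ℝ}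
    (ha : p a) (ε : ℝ) : ∀ᵐ x ∂(μ.mix a ε).toMeasure, p x := by
  rw [mix, ae_add_measure_iff]
  exact ⟨Measure.ae_smul_measure h _, Measure.ae_smul_measure (by simpa [ae_dirac_eq] using ha) _⟩

open MeasureTheory Filter Topology in
theorem boundedMgfRelation_subset_closure : boundedMgfRelation ⊆ closure strictMgfRelation := by
  rintro ⟨μ, ν⟩ ⟨⟨hμ, hν, hpos, hneg⟩, A, hA, hμA, hνA⟩
  -- The atoms lie one unit beyond the one-sided bounds of the other measure. The same weight `ε`
  -- thus gives the linear gap near `0` and dominance for large `|l|`.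
  refine mem_closure_of_tendsto ((μ.tendsto_mix (-(A + 1))).prodMk_nhds (ν.tendsto_mix (A + 1)))
    (.of_forall fun n => ?_)
  set ε : ℝ := 1 / ((n : ℝ) + 1)
  have h0 : 0 < ε := by positivity
  have h1 : ε ≤ 1 := by
    rw [div_le_one (by positivity)]
    linarith [n.cast_nonneg (α := ℝ)]
  have hint (ρ : ExpMeasure) (a l : ℝ) := ρ.integral_mix a h0.le h1
    (f := fun x => Real.exp (l * x)) (by fun_prop) (subexponential_exp l)
  refine ⟨ExpMeasure.mix_mem_PExp hμ _ h0.le h1, ExpMeasure.mix_mem_PExp hν _ h0.le h1, A, ε, hA,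
    h0, ExpMeasure.ae_mix hμA (by linarith) ε, ExpMeasure.ae_mix hνA (by linarith) ε,
    ν.le_real_mix Set.self_mem_Ici, μ.le_real_mix Set.self_mem_Iic,
    fun l hl => ?_, fun l hl => ?_⟩
  · simp only [hint]
    have := mul_le_mul_of_nonneg_left (mul_le_exp_sub_exp_neg hA hl) h0.le
    have := mul_le_mul_of_nonneg_left (hpos l hl.le) (sub_nonneg.2 h1)
    linarith
  · simp only [hint]
    have h2 := mul_le_mul_of_nonneg_left (mul_le_exp_sub_exp_neg hA (neg_pos.2 hl)) h0.le
    rw [neg_mul, neg_mul, mul_neg l, neg_neg] at h2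
    have := mul_le_mul_of_nonneg_left (hneg l hl.le) (sub_nonneg.2 h1)
    rw [mul_neg l]
    linarith

/-! ### Rounding to a finite lattice -/

/-- Truncation to `[-(N + 1), N + 1]`, followed by rounding down to a multiple of `1 / (N + 1)`. -/
noncomputable def latticeFloor (N : ℕ) (x : ℝ) : ℝ :=
  ⌊((N : ℝ) + 1) * max (-((N : ℝ) + 1)) (min x (N + 1))⌋ / ((N : ℝ) + 1)

theorem measurable_latticeFloor (N : ℕ) : Measurable (latticeFloor N) := by
  unfold latticeFloor
  fun_prop

theorem latticeFloor_le (N : ℕ) (x : ℝ) :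
    latticeFloor N x ≤ max (-((N : ℝ) + 1)) (min x (N + 1)) := by
  rw [latticeFloor, div_le_iff₀' (by positivity)]
  exact Int.floor_le _

theorem le_latticeFloor (N : ℕ) (x : ℝ) :
    max (-((N : ℝ) + 1)) (min x (N + 1)) - 1 / ((N : ℝ) + 1) ≤ latticeFloor N x := by
  have hN : 0 < (N : ℝ) + 1 := by positivity
  rw [latticeFloor, le_div_iff₀' hN, mul_sub, mul_one_div_cancel hN.ne']
  exact (Int.sub_one_lt_floor _).le

theorem abs_latticeFloor_le (N : ℕ) (x : ℝ) : |latticeFloor N x| ≤ |x| + 1 := by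
  have h1 := latticeFloor_le N x
  have h2 := le_latticeFloor N x
  have hN : 1 ≤ (N : ℝ) + 1 := by linarith [N.cast_nonneg (α := ℝ)]
  have h3 : 1 / ((N : ℝ) + 1) ≤ 1 := by rwa [div_le_one (by positivity)]
  have h4 := le_abs_self x
  have h5 := neg_abs_le x
  have h6 := abs_nonneg x
  have h7 : max (-((N : ℝ) + 1)) (min x (N + 1)) ≤ |x| :=
    max_le (by linarith) ((min_le_left _ _).trans h4)
  have h8 : -|x| ≤ max (-((N : ℝ) + 1)) (min x (N + 1)) :=
    le_max_of_le_right (le_min h5 (by linarith))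
  rw [abs_le]
  constructor <;> linarith

/-- Rounding costs at most `1 / (N + 1)`. Truncation costs at most `|x|`, and only where `|x| > N +
1`, hence at most `|x| ^ 2 / (N + 1)`; the exponential absorbs the square. -/
theorem abs_latticeFloor_sub_le (N : ℕ) (x : ℝ) :
    |latticeFloor N x - x| ≤ 2 / ((N : ℝ) + 1) * Real.exp |x| := by
  have h1 := latticeFloor_le N x
  have h2 := le_latticeFloor N x
  have hN : 0 < (N : ℝ) + 1 := by positivity
  have hy : |max (-((N : ℝ) + 1)) (min x (N + 1)) - x| ≤ |x| ^ 2 / ((N : ℝ) + 1) := by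
    rcases le_or_gt |x| ((N : ℝ) + 1) with h | h
    · have := abs_le.1 h
      rw [min_eq_left this.2, max_eq_right this.1, sub_self, abs_zero]
      positivity
    · have h3 : |max (-((N : ℝ) + 1)) (min x (N + 1)) - x| ≤ |x| := by
        have h4 := le_abs_self x
        have h5 := neg_abs_le x
        rw [abs_le]
        rcases max_cases (-((N : ℝ) + 1)) (min x (N + 1)) with ⟨h, _⟩ | ⟨h, _⟩ <;>
          rcases min_cases x ((N : ℝ) + 1) with ⟨h', _⟩ | ⟨h', _⟩ <;>
          rcases abs_cases x with ⟨h'', _⟩ | ⟨h'', _⟩ <;>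
          rw [h] at * <;> constructor <;> linarith
      rw [le_div_iff₀ hN, pow_two]
      exact mul_le_mul h3 h.le hN.le (abs_nonneg _)
  have he := Real.quadratic_le_exp_of_nonneg (abs_nonneg x)
  calc |latticeFloor N x - x| ≤ 1 / ((N : ℝ) + 1) + |x| ^ 2 / ((N : ℝ) + 1) := by
        rw [abs_le] at hy ⊢
        have : 0 ≤ 1 / ((N : ℝ) + 1) := by positivity
        constructor <;> linarith
    _ = (1 + |x| ^ 2) / ((N : ℝ) + 1) := by ring
    _ ≤ 2 * Real.exp |x| / ((N : ℝ) + 1) := by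
        gcongr
        nlinarith [abs_nonneg x]
    _ = _ := by ring

theorem latticeFloor_le_of_le {A : ℝ} (N : ℕ) {x : ℝ} (hA : -((N : ℝ) + 1) ≤ A) (hx : x ≤ A) :
    latticeFloor N x ≤ A :=
  (latticeFloor_le N x).trans (max_le hA ((min_le_left _ _).trans hx))

open Filter Topology in
theorem tendsto_latticeFloor (x : ℝ) : Tendsto (fun N => latticeFloor N x) atTop (𝓝 x) := by
  rw [tendsto_iff_norm_sub_tendsto_zero]
  refine squeeze_zero (fun _ => norm_nonneg _) (fun N => abs_latticeFloor_sub_le N x) ?_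
  have := (tendsto_one_div_add_atTop_nhds_zero_nat (𝕜 := ℝ)).const_mul 2 |>.mul_const (Real.exp |x|)
  simpa [← div_eq_mul_inv] using this

theorem exists_latticeFloor_eq (N : ℕ) : ∃ a : ℝ → ℕ, Measurable a ∧
    (∀ x, a x ≤ 2 * (N + 1) ^ 2) ∧
    ∀ x, latticeFloor N x = 1 / ((N : ℝ) + 1) * a x + -((N : ℝ) + 1) := by
  have hN : 0 < (N : ℝ) + 1 := by positivity
  have hl (x : ℝ) : -((N : ℤ) + 1) ^ 2 ≤
      ⌊((N : ℝ) + 1) * max (-((N : ℝ) + 1)) (min x (N + 1))⌋ := by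
    rw [Int.le_floor]
    push_cast
    have := mul_le_mul_of_nonneg_left (le_max_left (-((N : ℝ) + 1)) (min x (N + 1))) hN.le
    linarith
  have hu (x : ℝ) : ⌊((N : ℝ) + 1) * max (-((N : ℝ) + 1)) (min x (N + 1))⌋ ≤
      ((N : ℤ) + 1) ^ 2 := by
    rw [← Int.cast_le (R := ℝ)]
    refine (Int.floor_le _).trans ?_
    push_cast
    have := mul_le_mul_of_nonneg_left
      (max_le (by linarith : -((N : ℝ) + 1) ≤ N + 1) (min_le_right x ((N : ℝ) + 1))) hN.le
    linarith
  refine ⟨fun x => (⌊((N : ℝ) + 1) * max (-((N : ℝ) + 1)) (min x (N + 1))⌋ +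
    ((N : ℤ) + 1) ^ 2).toNat, ?_, fun x => ?_, fun x => ?_⟩
  · have h1 : Measurable fun x : ℝ => ((N : ℝ) + 1) * max (-((N : ℝ) + 1)) (min x (N + 1)) := by
      fun_prop
    exact (measurable_of_countable fun z : ℤ => (z + ((N : ℤ) + 1) ^ 2).toNat).comp h1.floor
  · have := hu x
    rw [Int.toNat_le]
    push_cast
    linarith
  · have : 0 ≤ ⌊((N : ℝ) + 1) * max (-((N : ℝ) + 1)) (min x (N + 1))⌋ + ((N : ℤ) + 1) ^ 2 := by
      have := hl x
      linarith
    have hz := congrArg (Int.cast (R := ℝ)) (Int.toNat_of_nonneg this)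
    rw [Int.cast_natCast] at hz
    beta_reduce
    rw [hz, latticeFloor]
    push_cast
    field_simp
    ring

/-- Conjugating by `x ↦ -x` rounds up instead of down. The truncation interval is symmetric with
lattice endpoints, so both roundings use the same lattice and the same index bound. -/
theorem exists_neg_latticeFloor_neg_eq (N : ℕ) : ∃ a : ℝ → ℕ, Measurable a ∧
    (∀ x, a x ≤ 2 * (N + 1) ^ 2) ∧
    ∀ x, -latticeFloor N (-x) = 1 / ((N : ℝ) + 1) * a x + -((N : ℝ) + 1) := by
  have hN : 0 < (N : ℝ) + 1 := by positivity
  obtain ⟨a, ha, haN, h⟩ := exists_latticeFloor_eq N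
  refine ⟨fun x => 2 * (N + 1) ^ 2 - a (-x), ?_, fun x => Nat.sub_le _ _, fun x => ?_⟩
  · exact (measurable_of_countable fun z : ℕ => 2 * (N + 1) ^ 2 - z).comp (ha.comp measurable_neg)
  · rw [h, Nat.cast_sub (haN _)]
    push_cast
    field_simp
    ring

theorem abs_exp_sub_exp_le {u v m : ℝ} (hu : |u| ≤ m) (hv : |v| ≤ m) :
    |Real.exp u - Real.exp v| ≤ |u - v| * Real.exp m := by
  wlog h : v ≤ u generalizing u v
  · rw [abs_sub_comm, abs_sub_comm u]
    exact this hv hu (le_of_not_ge h)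
  rw [abs_of_nonneg (sub_nonneg.2 (Real.exp_le_exp.2 h)), abs_of_nonneg (sub_nonneg.2 h)]
  have h1 := Real.add_one_le_exp (v - u)
  have h2 : Real.exp (v - u) * Real.exp u = Real.exp v := by rw [← Real.exp_add]; simp
  have h3 : Real.exp u ≤ Real.exp m := Real.exp_le_exp.2 ((le_abs_self u).trans hu)
  nlinarith [Real.exp_pos u]

/-! ### Stability of the strict inequalities under rounding -/

-- The factor `l` in the error is essential: it lets a gap `c * l` absorb the error all the way down
-- to `l = 0`.
open MeasureTheory in
theorem abs_integral_exp_sub_le (μ : ExpMeasure) (L : ℝ) : ∃ K : ℝ,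
    ∀ (u : ℝ → ℝ) (δ l : ℝ), Measurable u → (∀ x, |u x| ≤ |x| + 1) →
      (∀ x, |u x - x| ≤ δ * Real.exp |x|) → 0 < l → l ≤ L →
      |∫ x, Real.exp (l * u x) ∂μ.toMeasure - ∫ x, Real.exp (l * x) ∂μ.toMeasure| ≤
        l * δ * K := by
  refine ⟨∫ x, Real.exp L * Real.exp ((1 + L) * |x|) ∂μ.toMeasure,
    fun u δ l hu hb hδ hl0 hl => ?_⟩
  have hiu : Integrable (fun x => Real.exp (l * u x)) μ.toMeasure :=
    (integrable_map_measure (by fun_prop) hu.aemeasurable).1 ((μ.map u hu hb).expIntegrable l)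
  rw [← integral_sub hiu (μ.expIntegrable l), ← integral_const_mul, ← Real.norm_eq_abs]
  refine norm_integral_le_of_norm_le
    (((μ.integrable_exp_abs (1 + L)).const_mul _).const_mul _) (.of_forall fun x => ?_)
  have h1 (y : ℝ) (hy : |y| ≤ |x| + 1) : |l * y| ≤ L * (|x| + 1) := by
    rw [abs_mul, abs_of_pos hl0]
    gcongr
    linarith
  calc ‖Real.exp (l * u x) - Real.exp (l * x)‖
      ≤ |l * u x - l * x| * Real.exp (L * (|x| + 1)) :=
        abs_exp_sub_exp_le (h1 _ (hb x)) (h1 _ (by linarith))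
    _ ≤ l * (δ * Real.exp |x|) * Real.exp (L * (|x| + 1)) := by
        rw [← mul_sub, abs_mul, abs_of_pos hl0]
        gcongr
        exact hδ x
    _ = l * δ * (Real.exp L * Real.exp ((1 + L) * |x|)) := by
        rw [← Real.exp_add, ← mul_assoc, mul_assoc, ← Real.exp_add]
        ring_nf

open MeasureTheory Filter in
/-- The lattice approximations inherit the strict inequality of the moment generating functions on
the positive half-line. -/
theorem eventually_integral_exp_latticeFloor_lt {α β : ExpMeasure} (hα : α ∈ PExp) {A c : ℝ}
    (hA : 0 ≤ A) (hc : 0 < c) (hαA : ∀ᵐ x ∂α.toMeasure, x ≤ A)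
    (hβA : c ≤ β.toMeasure.real (Set.Ici (A + 1)))
    (h : ∀ l, 0 < l → ∫ x, Real.exp (l * x) ∂α.toMeasure + c * l ≤
      ∫ x, Real.exp (l * x) ∂β.toMeasure) :
    ∀ᶠ N : ℕ in atTop,
      (∀ l, 0 < l → ∫ x, Real.exp (l * latticeFloor N x) ∂α.toMeasure <
        ∫ x, Real.exp (l * -latticeFloor N (-x)) ∂β.toMeasure) ∧
      ∀ l, 0 < l → l ≤ 1 → c / 2 * l ≤ ∫ x, Real.exp (l * -latticeFloor N (-x)) ∂β.toMeasure -
        ∫ x, Real.exp (l * latticeFloor N x) ∂α.toMeasure := by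
  have : IsProbabilityMeasure α.toMeasure := hα
  have := β.isFiniteMeasure
  -- Up to `L` the rounding error is absorbed by the linear gap. Beyond `L` one has `c * exp l > 1`,
  -- which suffices for a comparison of tails; the `1` makes `L` cover the range `l ≤ 1` of the
  -- second claim.
  set L := max 1 (1 / c)
  obtain ⟨K₁, hK₁⟩ := abs_integral_exp_sub_le α L
  obtain ⟨K₂, hK₂⟩ := abs_integral_exp_sub_le β L
  have hlim : Tendsto (fun N : ℕ => 2 / ((N : ℝ) + 1) * (K₁ + K₂)) atTop (nhds 0) := by
    have := (tendsto_one_div_add_atTop_nhds_zero_nat (𝕜 := ℝ)).const_mul 2 |>.mul_const (K₁ + K₂)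
    simpa [← div_eq_mul_inv] using this
  filter_upwards [hlim.eventually_lt_const (half_pos hc), eventually_ge_atTop ⌈A⌉₊] with N hN hNA
  have hNA : A ≤ N := Nat.ceil_le.1 hNA
  have hma : Measurable (latticeFloor N) := measurable_latticeFloor N
  have hmb : Measurable fun x => -latticeFloor N (-x) := (hma.comp measurable_neg).neg
  have hbb (x : ℝ) : |-latticeFloor N (-x)| ≤ |x| + 1 := by
    rw [abs_neg, ← abs_neg x]
    exact abs_latticeFloor_le N _
  have hia (l : ℝ) : Integrable (fun x => Real.exp (l * latticeFloor N x)) α.toMeasure :=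
    (integrable_map_measure (by fun_prop) hma.aemeasurable).1
      ((α.map _ hma (abs_latticeFloor_le N)).expIntegrable l)
  have hib (l : ℝ) : Integrable (fun x => Real.exp (l * -latticeFloor N (-x))) β.toMeasure :=
    (integrable_map_measure (by fun_prop) hmb.aemeasurable).1 ((β.map _ hmb hbb).expIntegrable l)
  have hsmall (l : ℝ) (hl0 : 0 < l) (hl : l ≤ L) : c / 2 * l ≤
      ∫ x, Real.exp (l * -latticeFloor N (-x)) ∂β.toMeasure -
        ∫ x, Real.exp (l * latticeFloor N x) ∂α.toMeasure := by
    have h1 := abs_le.1 (hK₁ _ _ l hma (abs_latticeFloor_le N) (abs_latticeFloor_sub_le N) hl0 hl)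
    have h2 := abs_le.1 (hK₂ _ (2 / ((N : ℝ) + 1)) l hmb hbb (fun x => by
      rw [← abs_neg, ← abs_neg x]
      convert abs_latticeFloor_sub_le N (-x) using 2
      ring) hl0 hl)
    have h3 := mul_lt_mul_of_pos_left hN hl0
    have h4 := h l hl0
    linarith [h1.2, h2.1]
  refine ⟨fun l hl0 => ?_, fun l hl0 hl => hsmall l hl0 (hl.trans (le_max_left _ _))⟩
  rcases le_or_gt l L with hl | hl
  · have := hsmall l hl0 hl
    have : 0 < c / 2 * l := by positivity
    linarith
  -- For large `l` the directions of rounding matter: `α` rounded down stays below `A`, and `β`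
  -- rounded up keeps mass at least `c` above `A + 1`, as the truncation level `N + 1` is at least
  -- `A + 1`.
  · have h1 : ∫ x, Real.exp (l * latticeFloor N x) ∂α.toMeasure ≤ Real.exp (l * A) := by
      calc _ ≤ ∫ _, Real.exp (l * A) ∂α.toMeasure := by
            refine integral_mono_ae (hia l) (integrable_const _) ?_
            filter_upwards [hαA] with x hx
            have := latticeFloor_le_of_le N (by linarith) hx
            gcongr
        _ = _ := by simp
    have h2 : c * Real.exp (l * (A + 1)) ≤
        ∫ x, Real.exp (l * -latticeFloor N (-x)) ∂β.toMeasure := by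
      calc c * Real.exp (l * (A + 1))
          ≤ β.toMeasure.real (Set.Ici (A + 1)) * Real.exp (l * (A + 1)) := by gcongr
        _ = ∫ x, (Set.Ici (A + 1)).indicator (fun _ => Real.exp (l * (A + 1))) x ∂β.toMeasure := by
            rw [integral_indicator_const _ measurableSet_Ici, smul_eq_mul]
        _ ≤ _ := by
            refine integral_mono ((integrable_const _).indicator measurableSet_Ici) (hib l)
              fun x => Set.indicator_apply_le' (fun hx => ?_) (fun _ => (Real.exp_pos _).le)
            have := latticeFloor_le_of_le N (A := -(A + 1)) (x := -x) (by linarith)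
              (by linarith [Set.mem_Ici.1 hx])
            refine Real.exp_le_exp.2 (mul_le_mul_of_nonneg_left ?_ hl0.le)
            linarith
    have h3 : 1 < c * Real.exp l := by
      have h4 : 1 / c < l := (le_max_right _ _).trans_lt hl
      rw [div_lt_iff₀' hc] at h4
      nlinarith [Real.add_one_le_exp l]
    calc _ ≤ Real.exp (l * A) := h1
      _ < c * Real.exp l * Real.exp (l * A) := by nlinarith [Real.exp_pos (l * A)]
      _ = c * Real.exp (l * (A + 1)) := by
        rw [mul_assoc, ← Real.exp_add]
        ring_nf
      _ ≤ _ := h2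

open MeasureTheory Filter Topology in
theorem strictMgfRelation_subset_closure : strictMgfRelation ⊆ closure catRelation := by
  rintro ⟨μ, ν⟩ ⟨hμ, hν, A, c, hA, hc, hμA, hνA, hνc, hμc, hpos, hneg⟩
  simp only at hμ hν hμA hνA hνc hμc hpos hneg
  have : IsProbabilityMeasure μ.toMeasure := hμ
  have : IsProbabilityMeasure ν.toMeasure := hν
  have hma := measurable_latticeFloor
  have hmb (N : ℕ) : Measurable fun x => -latticeFloor N (-x) := ((hma N).comp measurable_neg).neg
  have hbb (N : ℕ) (x : ℝ) : |-latticeFloor N (-x)| ≤ |x| + 1 := by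
    rw [abs_neg, ← abs_neg x]
    exact abs_latticeFloor_le N _
  have htb (x : ℝ) : Tendsto (fun N => -latticeFloor N (-x)) atTop (𝓝 x) := by
    simpa using (tendsto_latticeFloor (-x)).neg
  refine mem_closure_of_tendsto ((μ.tendsto_map hma abs_latticeFloor_le
    tendsto_latticeFloor).prodMk_nhds (ν.tendsto_map hmb hbb htb)) ?_
  have hnb (x : ℝ) : |-x| ≤ |x| + 1 := by rw [abs_neg]; linarith
  have hE1 := eventually_integral_exp_latticeFloor_lt hμ hA hc hμA hνc hpos
  -- The negative half-line is the positive one after the reflection `x ↦ -x`, which exchanges the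
  -- roles of `μ` and `ν` and interchanges rounding down with rounding up.
  have hE2 := eventually_integral_exp_latticeFloor_lt (α := ν.map _ measurable_neg hnb)
    (β := μ.map _ measurable_neg hnb) (ExpMeasure.map_mem_PExp hν _ _) hA hc
    ((ae_map_iff measurable_neg.aemeasurable measurableSet_Iic).2
      (hνA.mono fun x hx => by linarith))
    (by
      rw [ExpMeasure.map, map_measureReal_apply measurable_neg measurableSet_Ici]
      simpa using hμc)
    (fun l hl => by
      rw [μ.integral_map _ _ (by fun_prop), ν.integral_map _ _ (by fun_prop)]
      simpa using hneg (-l) (by linarith))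
  filter_upwards [hE1, hE2] with N hN1 hN2
  refine ⟨ExpMeasure.map_mem_PExp hμ (hma N) (abs_latticeFloor_le N),
    ExpMeasure.map_mem_PExp hν (hmb N) (hbb N), ?_⟩
  obtain ⟨a, ha, haN, hae⟩ := exists_latticeFloor_eq N
  obtain ⟨b, hb, hbN, hbe⟩ := exists_neg_latticeFloor_neg_eq N
  have hrefl (ρ : ExpMeasure) (u : ℝ → ℝ) (hu : Measurable u) (l : ℝ) :
      ∫ x, Real.exp (l * u x) ∂(ρ.map _ measurable_neg hnb).toMeasure =
        ∫ x, Real.exp (l * u (-x)) ∂ρ.toMeasure :=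
    MeasureTheory.integral_map (f := fun x => Real.exp (l * u x)) measurable_neg.aemeasurable
      (by fun_prop)
  simp only [hrefl ν _ (hma N), hrefl μ _ (hmb N), neg_neg] at hN2
  have key := catStochDominated_map_lattice (μ := μ.toMeasure) (ν := ν.toMeasure) ha hb haN hbN
    (h := 1 / ((N : ℝ) + 1)) (s := -((N : ℝ) + 1)) (c := c / 2) (by positivity) (by positivity)
  simp only [← hae, ← hbe] at key
  refine key hN1.1 (fun l hl => ?_) ?_
  · simpa using hN2.1 (-l) (by linarith)
  · filter_upwards [Ioc_mem_nhdsGT one_pos] with l hl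
    exact hN1.2 l hl.1 hl.2

theorem mainTheorem11 :
    closure catRelation =
      {p : ExpMeasure × ExpMeasure | p.1 ∈ PExp ∧ p.2 ∈ PExp ∧
        (∀ l : ℝ, 0 ≤ l →
          ∫ x, Real.exp (l * x) ∂p.1.toMeasure ≤ ∫ x, Real.exp (l * x) ∂p.2.toMeasure) ∧
        (∀ l : ℝ, l ≤ 0 →
          ∫ x, Real.exp (l * x) ∂p.2.toMeasure ≤ ∫ x, Real.exp (l * x) ∂p.1.toMeasure)} := by
  refine (closure_minimal catRelation_subset_mgfRelation isClosed_mgfRelation).antisymm ?_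
  have h1 : closure strictMgfRelation ⊆ closure catRelation :=
    closure_minimal strictMgfRelation_subset_closure isClosed_closure
  have h2 : closure boundedMgfRelation ⊆ closure catRelation :=
    closure_minimal (boundedMgfRelation_subset_closure.trans h1) isClosed_closure
  exact mgfRelation_subset_closure.trans h2
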